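/- **Setting.** Let $\mathcal V,\mathcal Q,\mathcal H$ be real Hilbert spaces with a continuous embedding $\mathcal Q\hookrightarrow\mathcal H$, $\|q\|_{\mathcal H}\le C_{\mathrm{emb}}\|q\|_{\mathcal Q}$. Let $a$ on $\mathcal V$, $b$ on $\mathcal Q$, $c$ on $\mathcal H$ be symmetric bilinear forms that are continuous and elliptic with constants $C_a,c_a$, $C_b,c_b$, $C_c,c_c>0$, and let $d:\mathcal V\times\mathcal H\to\mathbb R$ be bilinear and bounded with $d(u,p)\le C_d\|u\|_{\mathcal V}\|p\|_{\mathcal H}$, $C_d>0$. Denote by $\mathcal A,\mathcal B,\mathcal C,\mathcal D$ the associated operators, and put $\mathcal M=\mathcal D\mathcal A^{-1}\mathcal D^*:\mathcal H\to\mathcal H^*$ and $\omega=C_d^2/(c_ac_c)$. For integers $k,\delta\ge1$ and a step size $\tau>0$ let $$\mathrm{BDF}_k y^n=\frac1\tau\sum_{\ell=0}^k\xi_{k,\ell}\,y^{n-\ell},\qquad \sum_{\ell=0}^k\xi_{k,\ell}\,y^{n-\ell}=\sum_{j=1}^k\frac1j\nabla^jy^n,\quad \nabla y^n=y^n-y^{n-1},$$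 $$\Delta_\delta y^n=\sum_{\ell=1}^\delta c_{\delta,\ell}\,y^{n-\ell},\qquad c_{\delta,\ell}=(-1)^{\ell-1}\binom\delta\ell .$$ **Assumptions on the method.** Let $\mathcal X\ne\{0\}$ be a real Hilbert space. There are $\eta\in[0,1)$ and, for every $\mu\in[0,\omega]$, a symmetric positive definite $G(\mu)\in\mathbb R^{(k+\delta)\times(k+\delta)}$ and $\gamma(\mu)\in\mathbb R^{k+\delta+1}$ such that for all sequences $(y^n)_{n\in\mathbb Z}$ in $\mathcal X$ and all $n$ $$\big\langle \tau\,\mathrm{BDF}_ky^n+\mu\,\Delta_\delta(\tau\,\mathrm{BDF}_ky^n),\;y^n-\eta y^{n-1}\big\rangle_{\mathcal X}=\|Y^n\|_{G(\mu)}^2-\|Y^{n-1}\|_{G(\mu)}^2+\Big\|\sum_{i=0}^{k+\delta}\gamma_i(\mu)\,y^{n-i}\Big\|_{\mathcal X}^2,$$ where $Y^n=(y^n,\dots,y^{n-k-\delta+1})\in\mathcal X^{k+\delta}$ and $\|Y\|_G^2=\langle GY,Y\rangle_{\mathcal X^{k+\delta}}$ (the identity does not depend on $\tau$). Moreover, the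 eigenvalues of all $G(\mu)$, $\mu\in[0,\omega]$, lie in an interval $[c_G,C_G]$ with $0<c_G\le C_G<\infty$. **Theorem.** Let $T>0$ and $K\ge0$. Then there is a constant $C>0$, depending only on $k$, $\delta$, $\eta$, $G$, $\gamma$, $T$, $K$ and the constants $C_a,c_a,C_b,c_b,C_c,c_c,C_d,C_{\mathrm{emb}}$ (in particular neither on $\tau$ and $n$ nor on the spaces), such that the following holds for every $\tau>0$ and every $r$ with values in $\mathcal Q^*$. Let $\bar p:[-\delta\tau,T]\to\mathcal H$, with $\bar p(t)\in\mathcal Q$ for $t\in(0,T]$, satisfy $$\mathcal C\dot{\bar p}(t)+\mathcal M\sum_{\ell=1}^\delta c_{\delta,\ell}\,\dot{\bar p}(t-\ell\tau)+\mathcal B\bar p(t)=r(t)\quad\text{in }\mathcal Q^*,\qquad t\in(0,T],$$ and let $\bar p$ be sufficiently smooth in the sense that $\bar p\in W^{k+1,\infty}(-\delta\tau,T;\mathcal H)$ with $\|\bar p^{(k+1)}\|_{L^\infty(-\delta\tau,T;\mathcal H)}\le K$. Let $t^n=n\tau$ and let $(p^n)$ be a sequence in $\mathcal H$ with arbitrary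 $p^0,\dots,p^{k-1}$, with the exact history $p^{-\ell}=\bar p(-\ell\tau)$ for $\ell=1,\dots,\delta$, and with $p^n\in\mathcal Q$ and $$\mathcal C\,\mathrm{BDF}_kp^n+\mathcal M\,\Delta_\delta\mathrm{BDF}_kp^n+\mathcal Bp^n=r(t^n)\quad\text{in }\mathcal Q^*\qquad\text{for all }n\ge k,\ t^n\le T.$$ Then for all $n\ge0$ with $t^n\le T$ $$\|p^n-\bar p(t^n)\|_{\mathcal H}^2+\tau\sum_{\ell=k}^n\|p^\ell-\bar p(t^\ell)\|_{\mathcal H}^2\le C\Big(\tau^{2k}+\sum_{\ell=0}^{k-1}\|p^\ell-\bar p(t^\ell)\|_{\mathcal H}^2\Big).$$ -/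

import Mathlib

/-! ### Difference operators -/

/-- The BDF-`k` coefficients `ξ_{k,ℓ}`, `0 ≤ ℓ ≤ k`, i.e. the coefficients of `y^{n-ℓ}` in
`∑_{j=1}^k (1/j) ∇^j y^n`, where `∇ y^n = y^n - y^{n-1}`. -/
noncomputable def bdfCoeff (k l : ℕ) : ℝ :=
  ∑ j ∈ Finset.Icc 1 k, (1 / (j : ℝ)) * ((-1) ^ l * (j.choose l : ℝ))

/-- The BDF-`k` operator with step size `τ`, `(1/τ) ∑_{ℓ=0}^k ξ_{k,ℓ} y^{n-ℓ}`. -/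
noncomputable def bdf {E : Type*} [AddCommGroup E] [Module ℝ E]
    (k : ℕ) (τ : ℝ) (y : ℤ → E) (n : ℤ) : E :=
  τ⁻¹ • ∑ l ∈ Finset.range (k + 1), bdfCoeff k l • y (n - l)

/-- The delay coefficients `c_{δ,ℓ} = (-1)^{ℓ-1} (δ choose ℓ)`, `1 ≤ ℓ ≤ δ`. -/
noncomputable def delayCoeff (δ l : ℕ) : ℝ := (-1) ^ (l - 1) * (δ.choose l : ℝ)

/-- The discrete delay operator `∑_{ℓ=1}^δ c_{δ,ℓ} y^{n-ℓ}`. -/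
noncomputable def discreteDelay {E : Type*} [AddCommGroup E] [Module ℝ E]
    (δ : ℕ) (y : ℤ → E) (n : ℤ) : E :=
  ∑ l ∈ Finset.Icc 1 δ, delayCoeff δ l • y (n - l)

/-! ### The summation assumption and the eigenvalue bounds -/

/-- The weighted square `‖Y‖_G² = ⟨G Y, Y⟩` on `X^s`. -/
noncomputable def gNormSq {X : Type*} [NormedAddCommGroup X] [InnerProductSpace ℝ X] {s : ℕ}
    (G : Matrix (Fin s) (Fin s) ℝ) (Y : Fin s → X) : ℝ :=
  ∑ i, inner ℝ (∑ j, G i j • Y j) (Y i)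

/-- The stacked vector `Y^n = [y^n, …, y^{n-s+1}]`. -/
def stacked {X : Type*} (s : ℕ) (y : ℤ → X) (n : ℤ) : Fin s → X :=
  fun i => y (n - (i : ℕ))

/-- The summation assumption on `[0, ω]` in the Hilbert space `X`, with the multiplier `η`,
the matrices `G μ` and the vectors `γ μ`. -/
structure SummationAssumption (X : Type*) [NormedAddCommGroup X] [InnerProductSpace ℝ X]
    (k δ : ℕ) (ω η : ℝ) (G : ℝ → Matrix (Fin (k + δ)) (Fin (k + δ)) ℝ)
    (γ : ℝ → Fin (k + δ + 1) → ℝ) : Prop where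
  eta_nonneg : 0 ≤ η
  eta_lt_one : η < 1
  posDef : ∀ μ ∈ Set.Icc 0 ω, (G μ).PosDef
  summation : ∀ μ ∈ Set.Icc 0 ω, ∀ τ : ℝ, 0 < τ → ∀ (y : ℤ → X) (n : ℤ),
    inner ℝ (τ • bdf k τ y n + μ • discreteDelay δ (fun m => τ • bdf k τ y m) n)
        (y n - η • y (n - 1))
      = gNormSq (G μ) (stacked (k + δ) y n) - gNormSq (G μ) (stacked (k + δ) y (n - 1))
        + ‖∑ i : Fin (k + δ + 1), γ μ i • y (n - (i : ℕ))‖ ^ 2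

/-- All eigenvalues of `G μ`, `μ ∈ [0, ω]`, are bounded away from zero and bounded above,
uniformly in `μ`. -/
def UniformEigenvalueBounds {s : ℕ} (ω : ℝ) (G : ℝ → Matrix (Fin s) (Fin s) ℝ) : Prop :=
  ∃ cG CG : ℝ, 0 < cG ∧
    ∀ μ ∈ Set.Icc 0 ω, ∀ x ∈ spectrum ℝ (G μ), cG ≤ x ∧ x ≤ CG

/-! ### The elliptic-parabolic problem -/

/-- The ellipticity and continuity constants of the bilinear forms and the constant of the
embedding of `Q` into `H`. -/
structure ProblemConstants where
  (ca Ca cb Cb cc Cc Cd Cemb : ℝ)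
  ca_pos : 0 < ca
  Ca_pos : 0 < Ca
  cb_pos : 0 < cb
  Cb_pos : 0 < Cb
  cc_pos : 0 < cc
  Cc_pos : 0 < Cc
  Cd_pos : 0 < Cd
  Cemb_pos : 0 < Cemb

/-- The coupling strength `ω = C_d² / (c_a c_c)`. -/
noncomputable def ProblemConstants.coupling (κ : ProblemConstants) : ℝ :=
  κ.Cd ^ 2 / (κ.ca * κ.cc)

/-- The spaces `V` and `Q ↪ H` together with the bilinear forms `a`, `b`, `c`, `d`. -/
structure EllipticParabolic (κ : ProblemConstants)
    (V Q H : Type*) [NormedAddCommGroup V] [InnerProductSpace ℝ V]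
    [NormedAddCommGroup Q] [InnerProductSpace ℝ Q]
    [NormedAddCommGroup H] [InnerProductSpace ℝ H] where
  emb : Q →L[ℝ] H
  emb_injective : Function.Injective emb
  emb_bound : ∀ q, ‖emb q‖ ≤ κ.Cemb * ‖q‖
  a : V →L[ℝ] V →L[ℝ] ℝ
  b : Q →L[ℝ] Q →L[ℝ] ℝ
  c : H →L[ℝ] H →L[ℝ] ℝ
  d : V →L[ℝ] H →L[ℝ] ℝ
  a_symm : ∀ u v, a u v = a v u
  b_symm : ∀ p q, b p q = b q p
  c_symm : ∀ p q, c p q = c q p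
  a_elliptic : ∀ v, κ.ca * ‖v‖ ^ 2 ≤ a v v
  b_elliptic : ∀ q, κ.cb * ‖q‖ ^ 2 ≤ b q q
  c_elliptic : ∀ q, κ.cc * ‖q‖ ^ 2 ≤ c q q
  a_bound : ∀ u v, |a u v| ≤ κ.Ca * ‖u‖ * ‖v‖
  b_bound : ∀ p q, |b p q| ≤ κ.Cb * ‖p‖ * ‖q‖
  c_bound : ∀ p q, |c p q| ≤ κ.Cc * ‖p‖ * ‖q‖
  d_bound : ∀ u p, d u p ≤ κ.Cd * ‖u‖ * ‖p‖

namespace EllipticParabolic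

variable {κ : ProblemConstants} {V Q H : Type*}
  [NormedAddCommGroup V] [InnerProductSpace ℝ V]
  [NormedAddCommGroup Q] [InnerProductSpace ℝ Q]
  [NormedAddCommGroup H] [InnerProductSpace ℝ H]

theorem isCoercive_a (P : EllipticParabolic κ V Q H) : IsCoercive P.a :=
  ⟨κ.ca, κ.ca_pos, fun v => by
    have h := P.a_elliptic v
    rw [pow_two, ← mul_assoc] at h
    exact h⟩

variable [CompleteSpace V]

theorem bijective_a (P : EllipticParabolic κ V Q H) : Function.Bijective P.a := by
  constructor
  · intro u v huv
    have h := P.a_elliptic (u - v)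
    have h0 : P.a (u - v) = 0 := by rw [map_sub, huv, sub_self]
    rw [h0] at h
    have h1 : κ.ca * ‖u - v‖ ^ 2 ≤ 0 := by simpa using h
    have h2 : ‖u - v‖ ^ 2 ≤ 0 := nonpos_of_mul_nonpos_right h1 κ.ca_pos
    have h3 : ‖u - v‖ = 0 := by
      have := sq_nonneg ‖u - v‖
      exact pow_eq_zero_iff (two_ne_zero) |>.1 (le_antisymm h2 this)
    exact sub_eq_zero.1 (norm_eq_zero.1 h3)
  · intro f
    set w := (InnerProductSpace.toDual ℝ V).symm f
    refine ⟨(P.isCoercive_a.continuousLinearEquivOfBilin).symm w, ?_⟩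
    ext v
    rw [← IsCoercive.continuousLinearEquivOfBilin_apply P.isCoercive_a]
    rw [ContinuousLinearEquiv.apply_symm_apply]
    exact InnerProductSpace.toDual_symm_apply

/-- The operator `A : V → V*` of the form `a`, as an isomorphism. -/
noncomputable def opA (P : EllipticParabolic κ V Q H) : V ≃L[ℝ] (V →L[ℝ] ℝ) :=
  ContinuousLinearEquiv.ofBijective P.a
    (LinearMap.ker_eq_bot.2 P.bijective_a.1) (LinearMap.range_eq_top.2 P.bijective_a.2)

/-- The operator `M = D A⁻¹ D* : H → H*`. -/
noncomputable def opM (P : EllipticParabolic κ V Q H) : H →L[ℝ] H →L[ℝ] ℝ :=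
  P.d.comp ((P.opA.symm : (V →L[ℝ] ℝ) →L[ℝ] V).comp P.d.flip)

/-- `p : [-δτ, T] → H` solves `C p' + M ∑_{ℓ=1}^δ c_{δ,ℓ} p'(· - ℓτ) + B p = r` in `Q*` on
`(0, T]`. On `(0, T]` the values of `p` lie in `Q`; on `[-δτ, 0]` the function `p` is its own
(`H`-valued) history. The time derivative is that of an `H`-valued function. -/
def IsDelaySolution (P : EllipticParabolic κ V Q H) (δ : ℕ) (τ T : ℝ)
    (r : ℝ → (Q →L[ℝ] ℝ)) (p : ℝ → H) : Prop :=
  ∀ t ∈ Set.Ioc 0 T, ∃ w : Q, P.emb w = p t ∧ ∀ q : Q,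
    P.c (derivWithin p (Set.Icc (-(δ * τ)) T) t) (P.emb q)
      + P.opM (∑ l ∈ Finset.Icc 1 δ,
          delayCoeff δ l • derivWithin p (Set.Icc (-(δ * τ)) T) (t - l * τ)) (P.emb q)
      + P.b w q = r t q

/-- The sequence `p` satisfies the BDF-`k` discretization
`C BDF(p^n) + M ∑_{ℓ=1}^δ c_{δ,ℓ} BDF(p^{n-ℓ}) + B p^n = r(t^n)` in `Q*`, `t^n = n τ`,
at all steps `n ≥ k` with `t^n ≤ T`. -/
def IsBDFSolution (P : EllipticParabolic κ V Q H) (k δ : ℕ) (τ T : ℝ)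
    (r : ℝ → (Q →L[ℝ] ℝ)) (p : ℤ → H) : Prop :=
  ∀ n : ℕ, k ≤ n → n * τ ≤ T → ∃ w : Q, P.emb w = p n ∧ ∀ q : Q,
    P.c (bdf k τ p n) (P.emb q) + P.opM (discreteDelay δ (bdf k τ p) n) (P.emb q)
      + P.b w q = r (n * τ) q

end EllipticParabolic

/-- `p` belongs to `W^{k+1,∞}(α, β; H)` with `(k+1)`-st derivative bounded by `K`: it is `k` times
continuously differentiable on `[α, β]` and its `k`-th derivative is `K`-Lipschitz. -/
def HasSobolevBound {H : Type*} [NormedAddCommGroup H] [NormedSpace ℝ H]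
    (k : ℕ) (K : NNReal) (α β : ℝ) (p : ℝ → H) : Prop :=
  ContDiffOn ℝ k p (Set.Icc α β) ∧
    LipschitzOnWith K (iteratedDerivWithin k p (Set.Icc α β)) (Set.Icc α β)

/-! The error `e^n = p^n - pbar(t^n)` solves the scheme with vanishing history and with a defect of
size `τ^k`: BDF-`k` differentiates polynomials of degree at most `k` exactly
(`sum_bdfCoeff_mul_pow`), so Taylor's formula bounds `BDF_k pbar - pbar'`
(`norm_bdf_sub_derivWithin_le`, `exists_error_equation`).

Stability is an energy argument with the multiplier `e^n - η e^{n-1}`. The difficulty is that the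
summation assumption is scalar in `μ` while the scheme contains the operator `M`. Because
`0 ≤ M ≤ ω C`, one can write `C BDF + M Δ BDF = S₀ BDF + S₁ (BDF + ω Δ BDF)` with the positive
semidefinite operators `S₀ = C - ω⁻¹ M` and `S₁ = ω⁻¹ M`; hence only `μ = 0` and `μ = ω` matter.
For each of these two values the summation assumption telescopes on real sequences
(`SummationAssumption.exists_scalar_energy`). The resulting inequality between quadratic forms on
real sequences holds with any positive semidefinite form in place of the product of reals, since
the Gram matrix of finitely many vectors is that of finitely many real sequences
(`form_energy_of_scalar_energy`). Adding both gives the energy inequality for the coupled operator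
(`SummationAssumption.exists_energy`).

The first step is separate, because `e^{k-1}` need not lie in `Q`: there the test function is `e^k`
(`first_step_bound`). In all later steps the ellipticity of `b` and `η < 1` absorb the defect
(`sum_evolution_add_sum_b_le`), and no Gronwall argument is needed. -/


/-! ### Moments of the BDF coefficients -/

/-- `ℓ ξ_{k,ℓ} = (-1)^ℓ (k choose ℓ)` for `ℓ ≥ 1`: weighting by `ℓ` turns the BDF coefficients into
those of `∇^k`, which annihilates polynomials of degree less than `k`. -/
theorem bdfCoeff_mul_succ (k m : ℕ) :
    bdfCoeff k (m + 1) * ((m + 1 : ℕ) : ℝ) = (-1) ^ (m + 1) * (k.choose (m + 1) : ℝ) := by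
  induction k with
  | zero => simp [bdfCoeff]
  | succ k ih =>
    have h : bdfCoeff (k + 1) (m + 1) = bdfCoeff k (m + 1)
        + (1 / ((k + 1 : ℕ) : ℝ)) * ((-1) ^ (m + 1) * ((k + 1).choose (m + 1) : ℝ)) := by
      rw [bdfCoeff, Finset.sum_Icc_succ_top (by omega), bdfCoeff]
    have h2 : ((k + 1 : ℕ) : ℝ) * (k.choose m : ℝ)
        = ((k + 1).choose (m + 1) : ℝ) * ((m + 1 : ℕ) : ℝ) := by
      exact_mod_cast Nat.add_one_mul_choose_eq k m
    have h3 : ((k + 1 : ℕ) : ℝ) ≠ 0 := by positivity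
    have h4 : (1 / ((k + 1 : ℕ) : ℝ)) * (((k + 1).choose (m + 1) : ℝ) * ((m + 1 : ℕ) : ℝ))
        = (k.choose m : ℝ) := by
      rw [← h2]; field_simp
    have h5 : ((k + 1).choose (m + 1) : ℝ) = k.choose m + k.choose (m + 1) := by
      exact_mod_cast Nat.choose_succ_succ k m
    rw [h, add_mul, ih]
    linear_combination (-1) ^ (m + 1) * h4 - (-1) ^ (m + 1) * h5

theorem alternating_sum_choose_mul_pow {k j : ℕ} (h : j < k) :
    ∑ l ∈ Finset.range (k + 1), (-1 : ℝ) ^ l * (k.choose l : ℝ) * (l : ℝ) ^ j = 0 := by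
  have h1 := congrFun (fwdDiff_iter_pow_eq_zero_of_lt (R := ℝ) h) 0
  rw [fwdDiff_iter_eq_sum_shift] at h1
  have h2 : ∑ l ∈ Finset.range (k + 1), (-1 : ℝ) ^ l * (k.choose l : ℝ) * (l : ℝ) ^ j
      = (-1) ^ k * ∑ l ∈ Finset.range (k + 1),
        ((-1 : ℤ) ^ (k - l) * (k.choose l : ℤ)) • ((0 : ℝ) + l • (1 : ℝ)) ^ j := by
    rw [Finset.mul_sum]
    refine Finset.sum_congr rfl fun l hl => ?_
    obtain ⟨d, rfl⟩ := Nat.exists_eq_add_of_le (Nat.lt_succ_iff.1 (Finset.mem_range.1 hl))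
    have : ((-1 : ℝ) ^ d) * (-1) ^ d = 1 := by rw [← mul_pow]; simp
    simp only [zero_add, nsmul_eq_mul, mul_one, zsmul_eq_mul, Int.cast_mul, Int.cast_pow,
      Int.cast_neg, Int.cast_one, Int.cast_natCast, Nat.add_sub_cancel_left, pow_add]
    linear_combination -((-1 : ℝ) ^ l * ((l + d).choose l : ℝ) * (l : ℝ) ^ j) * this
  rw [h2, h1]; simp

/-- The operator `∑ j ≤ k, ∇^j / j` annihilates constants. -/
theorem sum_bdfCoeff (k : ℕ) : ∑ l ∈ Finset.range (k + 1), bdfCoeff k l = 0 := by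
  simp only [bdfCoeff]
  rw [Finset.sum_comm]
  refine Finset.sum_eq_zero fun j hj => ?_
  obtain ⟨hj1, hjk⟩ := Finset.mem_Icc.1 hj
  rw [← Finset.mul_sum]
  have h := alternating_sum_choose_mul_pow (k := j) (j := 0) (by omega)
  simp only [pow_zero, mul_one] at h
  rw [← Finset.sum_subset (Finset.range_mono (show j + 1 ≤ k + 1 by omega)), h, mul_zero]
  intro l _ hl
  rw [Nat.choose_eq_zero_of_lt (by simpa using hl)]; simp

/-- Consistency of order `k`: BDF-`k` differentiates polynomials of degree at most `k` exactly. -/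
theorem sum_bdfCoeff_mul_pow {k j : ℕ} (hj : j ≤ k) :
    ∑ l ∈ Finset.range (k + 1), bdfCoeff k l * (l : ℝ) ^ j = if j = 1 then -1 else 0 := by
  rcases j with _ | j
  · simpa using sum_bdfCoeff k
  · have h := alternating_sum_choose_mul_pow (k := k) (j := j) (by omega)
    rw [Finset.sum_range_succ'] at h ⊢
    have h1 : ∀ l ∈ Finset.range k, bdfCoeff k (l + 1) * ((l + 1 : ℕ) : ℝ) ^ (j + 1)
        = (-1 : ℝ) ^ (l + 1) * (k.choose (l + 1) : ℝ) * ((l + 1 : ℕ) : ℝ) ^ j := by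
      intro l _
      rw [pow_succ', ← mul_assoc, bdfCoeff_mul_succ]
    rw [Finset.sum_congr rfl h1]
    rcases j with _ | j
    · simp at h ⊢; linarith
    · simp at h ⊢; linarith

theorem one_le_bdfCoeff_zero {k : ℕ} (hk : 1 ≤ k) : 1 ≤ bdfCoeff k 0 := by
  have h : (1 / ((1 : ℕ) : ℝ)) * ((-1) ^ 0 * ((1 : ℕ).choose 0 : ℝ)) ≤ bdfCoeff k 0 :=
    Finset.single_le_sum (f := fun j : ℕ => (1 / (j : ℝ)) * ((-1) ^ 0 * (j.choose 0 : ℝ)))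
      (fun i _ => by simp) (Finset.mem_Icc.2 ⟨le_rfl, hk⟩)
  simpa using h

/-! ### Consistency error of the BDF method -/

/-- Taylor's formula when the last derivative is only Lipschitz. The factor `1 / (k + 1)!` is
dropped, which makes the induction on `k` a plain use of the mean value inequality. -/
theorem norm_sub_taylorWithinEval_le {E : Type*} [NormedAddCommGroup E] [NormedSpace ℝ E]
    {α β : ℝ} (hαβ : α < β) {K : NNReal} (k : ℕ) {f : ℝ → E}
    (hf : ContDiffOn ℝ k f (Set.Icc α β))
    (hL : LipschitzOnWith K (iteratedDerivWithin k f (Set.Icc α β)) (Set.Icc α β))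
    {s t : ℝ} (hs : s ∈ Set.Icc α β) (ht : t ∈ Set.Icc α β) :
    ‖f s - taylorWithinEval f k (Set.Icc α β) t s‖ ≤ K * |s - t| ^ (k + 1) := by
  have hU := uniqueDiffOn_Icc hαβ
  induction k generalizing f s with
  | zero =>
    have := hL.dist_le_mul s hs t ht
    simpa [dist_eq_norm] using this
  | succ k ih =>
    have hf1 : ContDiffOn ℝ k (derivWithin f (Set.Icc α β)) (Set.Icc α β) :=
      hf.derivWithin hU (by norm_cast)
    have hL1 : LipschitzOnWith K
        (iteratedDerivWithin k (derivWithin f (Set.Icc α β)) (Set.Icc α β)) (Set.Icc α β) := by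
      rw [← iteratedDerivWithin_succ']; exact hL
    have hd : DifferentiableOn ℝ f (Set.Icc α β) := hf.differentiableOn (by simp)
    have hsub : Set.uIcc t s ⊆ Set.Icc α β := Set.OrdConnected.uIcc_subset inferInstance ht hs
    have key : ‖(f s - taylorWithinEval f (k + 1) (Set.Icc α β) t s)
        - (f t - taylorWithinEval f (k + 1) (Set.Icc α β) t t)‖
        ≤ (K * |s - t| ^ (k + 1)) * ‖s - t‖ := by
      refine Convex.norm_image_sub_le_of_norm_hasDerivWithin_le
        (f := fun x => f x - taylorWithinEval f (k + 1) (Set.Icc α β) t x)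
        (f' := fun x => derivWithin f (Set.Icc α β) x
          - taylorWithinEval (derivWithin f (Set.Icc α β)) k (Set.Icc α β) t x)
        (s := Set.uIcc t s) (fun x hx => ?_) (fun x hx => ?_) (convex_uIcc t s)
        Set.left_mem_uIcc Set.right_mem_uIcc
      · exact ((hd x (hsub hx)).hasDerivWithinAt.mono hsub).sub
          (hasDerivAt_taylorWithinEval_succ f k).hasDerivWithinAt
      · refine (ih hf1 hL1 (hsub hx)).trans ?_
        exact mul_le_mul_of_nonneg_left
          (pow_le_pow_left₀ (abs_nonneg _) (Set.abs_sub_left_of_mem_uIcc hx) _) K.2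
    rw [taylorWithinEval_self, sub_self, sub_zero] at key
    rw [pow_succ, ← mul_assoc]
    exact key

/-- The constant of the consistency error of BDF-`k`. -/
noncomputable def bdfErrorConst (k : ℕ) : ℝ :=
  ∑ l ∈ Finset.range (k + 1), |bdfCoeff k l| * (l : ℝ) ^ (k + 1)

theorem bdfErrorConst_nonneg (k : ℕ) : 0 ≤ bdfErrorConst k :=
  Finset.sum_nonneg fun _ _ => by positivity

/-- The BDF operator and the derivative agree at `mτ` on the Taylor polynomial of degree `k` there,
so only the Taylor remainder at the `k + 1` nodes contributes. -/
theorem norm_bdf_sub_derivWithin_le {E : Type*} [NormedAddCommGroup E] [NormedSpace ℝ E]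
    {k : ℕ} (hk : 1 ≤ k) {K : NNReal} {α β τ : ℝ} (hτ : 0 < τ) {f : ℝ → E}
    (hf : HasSobolevBound k K α β f) {m : ℤ} (hm : α ≤ (m - k) * τ) (hm' : m * τ ≤ β) :
    ‖bdf k τ (fun i => f (i * τ)) m - derivWithin f (Set.Icc α β) (m * τ)‖
      ≤ K * bdfErrorConst k * τ ^ k := by
  have hk' : (0 : ℝ) < k := by exact_mod_cast hk
  have hkτ : 0 < k * τ := by positivity
  have hαβ : α < β := by nlinarith
  have ht : (m : ℝ) * τ ∈ Set.Icc α β := ⟨by nlinarith, hm'⟩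
  set I := Set.Icc α β
  set t : ℝ := m * τ
  have hexact : ∑ l ∈ Finset.range (k + 1),
      bdfCoeff k l • taylorWithinEval f k I t (t - l * τ) = τ • derivWithin f I t := by
    simp only [taylor_within_apply, Finset.smul_sum, smul_smul]
    rw [Finset.sum_comm]
    have h1 : ∀ j ∈ Finset.range (k + 1), ∑ l ∈ Finset.range (k + 1),
        (bdfCoeff k l * ((j.factorial : ℝ)⁻¹ * (t - l * τ - t) ^ j)) • iteratedDerivWithin j f I t
        = if j = 1 then τ • derivWithin f I t else 0 := by
      intro j hj
      have h2 := sum_bdfCoeff_mul_pow (Nat.lt_succ_iff.1 (Finset.mem_range.1 hj))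
      have h3 : ∑ l ∈ Finset.range (k + 1),
          (bdfCoeff k l * ((j.factorial : ℝ)⁻¹ * (t - l * τ - t) ^ j))
          = ((j.factorial : ℝ)⁻¹ * (-τ) ^ j) *
            ∑ l ∈ Finset.range (k + 1), bdfCoeff k l * (l : ℝ) ^ j := by
        rw [Finset.mul_sum]
        refine Finset.sum_congr rfl fun l _ => ?_
        rw [show t - l * τ - t = -τ * l by ring, mul_pow]; ring
      rw [← Finset.sum_smul, h3, h2]
      split_ifs with hj1
      · subst hj1; simp [iteratedDerivWithin_one]
      · simp
    rw [Finset.sum_congr rfl h1, Finset.sum_ite_eq' (Finset.range (k + 1)) 1 fun _ =>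
      τ • derivWithin f I t, if_pos (Finset.mem_range.2 (by omega))]
  have hbdf : bdf k τ (fun i => f (i * τ)) m - derivWithin f I t
      = τ⁻¹ • ∑ l ∈ Finset.range (k + 1),
        bdfCoeff k l • (f (t - l * τ) - taylorWithinEval f k I t (t - l * τ)) := by
    simp only [smul_sub, Finset.sum_sub_distrib]
    rw [hexact, smul_smul, inv_mul_cancel₀ hτ.ne', one_smul, bdf]
    have harg : ∀ l : ℕ, ((m - l : ℤ) : ℝ) * τ = t - l * τ := fun l => by
      push_cast; ring
    simp only [harg]
  rw [hbdf, norm_smul, norm_inv, Real.norm_of_nonneg hτ.le]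
  have hsum : ‖∑ l ∈ Finset.range (k + 1),
        bdfCoeff k l • (f (t - l * τ) - taylorWithinEval f k I t (t - l * τ))‖
      ≤ K * bdfErrorConst k * τ ^ (k + 1) := by
    refine (norm_sum_le _ _).trans ?_
    rw [bdfErrorConst, Finset.mul_sum, Finset.sum_mul]
    refine Finset.sum_le_sum fun l hl => ?_
    have hl' : (l : ℝ) ≤ k := by exact_mod_cast Nat.lt_succ_iff.1 (Finset.mem_range.1 hl)
    have hs : t - l * τ ∈ I := by
      constructor
      · have : (l : ℝ) * τ ≤ k * τ := by gcongr
        simp only [t]; linarith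
      · have : 0 ≤ (l : ℝ) * τ := by positivity
        linarith
    have h4 := norm_sub_taylorWithinEval_le hαβ k hf.1 hf.2 hs ht
    rw [show t - l * τ - t = -(l * τ) by ring, abs_neg, abs_of_nonneg (by positivity),
      mul_pow] at h4
    rw [norm_smul, Real.norm_eq_abs]
    calc |bdfCoeff k l| * _ ≤ |bdfCoeff k l| * (K * ((l : ℝ) ^ (k + 1) * τ ^ (k + 1))) := by gcongr
      _ = _ := by ring
  calc τ⁻¹ * _ ≤ τ⁻¹ * (K * bdfErrorConst k * τ ^ (k + 1)) := by gcongr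
    _ = K * bdfErrorConst k * τ ^ k := by rw [pow_succ]; field_simp

/-! ### Linear maps and the difference operators -/

section LinearMaps

variable {E F : Type*} [AddCommGroup E] [Module ℝ E] [AddCommGroup F] [Module ℝ F]

theorem map_bdf (f : E →ₗ[ℝ] F) (k : ℕ) (τ : ℝ) (y : ℤ → E) (n : ℤ) :
    f (bdf k τ y n) = bdf k τ (fun i => f (y i)) n := by
  simp [bdf, map_sum]

theorem map_discreteDelay (f : E →ₗ[ℝ] F) (δ : ℕ) (y : ℤ → E) (n : ℤ) :
    f (discreteDelay δ y n) = discreteDelay δ (fun i => f (y i)) n := by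
  simp [discreteDelay, map_sum]

theorem bdf_sub (k : ℕ) (τ : ℝ) (y z : ℤ → E) (n : ℤ) :
    bdf k τ (fun i => y i - z i) n = bdf k τ y n - bdf k τ z n := by
  simp [bdf, smul_sub, Finset.sum_sub_distrib]

theorem discreteDelay_sub (δ : ℕ) (y z : ℤ → E) (n : ℤ) :
    discreteDelay δ (fun i => y i - z i) n = discreteDelay δ y n - discreteDelay δ z n := by
  simp [discreteDelay, smul_sub, Finset.sum_sub_distrib]

theorem discreteDelay_smul (δ : ℕ) (a : ℝ) (y : ℤ → E) (n : ℤ) :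
    discreteDelay δ (fun i => a • y i) n = a • discreteDelay δ y n :=
  (map_discreteDelay (LinearMap.lsmul ℝ E a) δ y n).symm

theorem bdf_congr {k : ℕ} {τ : ℝ} {y z : ℤ → E} {n : ℤ}
    (h : ∀ i, n - k ≤ i → i ≤ n → y i = z i) : bdf k τ y n = bdf k τ z n := by
  unfold bdf
  congr 1
  refine Finset.sum_congr rfl fun l hl => ?_
  have := Finset.mem_range.1 hl
  rw [h _ (by omega) (by omega)]

theorem discreteDelay_congr {δ : ℕ} {y z : ℤ → E} {n : ℤ}
    (h : ∀ i, n - δ ≤ i → i ≤ n → y i = z i) : discreteDelay δ y n = discreteDelay δ z n := by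
  unfold discreteDelay
  refine Finset.sum_congr rfl fun l hl => ?_
  have := Finset.mem_Icc.1 hl
  rw [h _ (by omega) (by omega)]

/-- The delayed BDF operator `τ BDF_k + μ Δ_δ (τ BDF_k)`. -/
noncomputable def delayedBdf (k δ : ℕ) (τ μ : ℝ) (y : ℤ → E) (n : ℤ) : E :=
  τ • bdf k τ y n + μ • discreteDelay δ (fun m => τ • bdf k τ y m) n

theorem map_delayedBdf (f : E →ₗ[ℝ] F) (k δ : ℕ) (τ μ : ℝ) (y : ℤ → E) (n : ℤ) :
    f (delayedBdf k δ τ μ y n) = delayedBdf k δ τ μ (fun i => f (y i)) n := by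
  simp [delayedBdf, map_discreteDelay, map_bdf]

theorem delayedBdf_congr {k δ : ℕ} {τ μ : ℝ} {y z : ℤ → E} {n : ℤ}
    (h : ∀ i, n - (k + δ) ≤ i → i ≤ n → y i = z i) :
    delayedBdf k δ τ μ y n = delayedBdf k δ τ μ z n := by
  unfold delayedBdf
  rw [bdf_congr fun i hi hi' => h i (by omega) hi']
  congr 2
  refine discreteDelay_congr fun m hm hm' => ?_
  rw [bdf_congr fun i hi hi' => h i (by omega) (by omega)]

end LinearMaps

/-! ### The energy inequality for scalar sequences -/

/-- The lower bound comes from compactness of the unit sphere; only a single component is kept on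
its left-hand side, which is all that the energy argument needs. -/
theorem exists_gNormSq_bounds {s : ℕ} {G : Matrix (Fin s) (Fin s) ℝ} (hG : G.PosDef) :
    ∃ cG CG : ℝ, 0 < cG ∧ 0 < CG ∧ ∀ Y : Fin s → ℝ,
      (∀ i, cG * Y i ^ 2 ≤ gNormSq G Y) ∧ gNormSq G Y ≤ CG * ∑ i, Y i ^ 2 := by
  have hq : ∀ Y : Fin s → ℝ, gNormSq G Y = Y ⬝ᵥ (G.mulVec Y) := by
    intro Y
    simp [gNormSq, dotProduct, Matrix.mulVec]
  have hup : ∃ CG : ℝ, 0 < CG ∧ ∀ Y : Fin s → ℝ, gNormSq G Y ≤ CG * ∑ i, Y i ^ 2 := by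
    refine ⟨1 + ∑ i, ∑ j, |G i j|, by positivity, fun Y => ?_⟩
    have h1 : gNormSq G Y ≤ (∑ i, ∑ j, |G i j|) * ∑ i, Y i ^ 2 := by
      rw [hq, Finset.sum_mul, dotProduct]
      refine Finset.sum_le_sum fun i _ => ?_
      rw [Matrix.mulVec, dotProduct, Finset.mul_sum, Finset.sum_mul]
      refine Finset.sum_le_sum fun j _ => ?_
      have hi : Y i ^ 2 ≤ ∑ i, Y i ^ 2 :=
        Finset.single_le_sum (f := fun i => Y i ^ 2) (fun i _ => sq_nonneg _) (Finset.mem_univ i)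
      have hj : Y j ^ 2 ≤ ∑ i, Y i ^ 2 :=
        Finset.single_le_sum (f := fun i => Y i ^ 2) (fun i _ => sq_nonneg _) (Finset.mem_univ j)
      have h2 : |Y i * Y j| ≤ ∑ i, Y i ^ 2 := by
        rw [abs_le]; constructor <;> nlinarith [sq_nonneg (Y i - Y j), sq_nonneg (Y i + Y j)]
      calc Y i * (G i j * Y j) ≤ |G i j * (Y i * Y j)| := by
            rw [show Y i * (G i j * Y j) = G i j * (Y i * Y j) by ring]; exact le_abs_self _
        _ = |G i j| * |Y i * Y j| := abs_mul _ _
        _ ≤ _ := by gcongr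
    have h3 : 0 ≤ ∑ i, Y i ^ 2 := Finset.sum_nonneg fun i _ => sq_nonneg _
    linarith
  have hlow : ∃ cG : ℝ, 0 < cG ∧ ∀ Y : Fin s → ℝ, ∀ i, cG * Y i ^ 2 ≤ gNormSq G Y := by
    have hcont : Continuous fun Y : Fin s → ℝ => gNormSq G Y := by
      unfold gNormSq; fun_prop
    obtain ⟨c, hc, hcY⟩ := (isCompact_sphere (0 : Fin s → ℝ) 1).exists_forall_le'
      hcont.continuousOn (a := 0) fun Y hY => by
        have hY0 : Y ≠ 0 := by
          rintro rfl; simp at hY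
        simpa [hq] using hG.dotProduct_mulVec_pos hY0
    refine ⟨c, hc, fun Y i => ?_⟩
    rcases eq_or_ne Y 0 with rfl | hY0
    · simp [gNormSq]
    have hn : 0 < ‖Y‖ := norm_pos_iff.2 hY0
    have h1 := hcY (‖Y‖⁻¹ • Y) (by simp [norm_smul, hn.ne'])
    have h2 : gNormSq G (‖Y‖⁻¹ • Y) = (‖Y‖ ^ 2)⁻¹ * gNormSq G Y := by
      rw [hq, hq, Matrix.mulVec_smul, dotProduct_smul, smul_dotProduct, smul_eq_mul, smul_eq_mul]
      field_simp
    rw [h2, ← div_eq_inv_mul, le_div_iff₀ (by positivity)] at h1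
    have h3 : Y i ^ 2 ≤ ‖Y‖ ^ 2 := sq_le_sq' (abs_le.1 (norm_le_pi_norm Y i)).1
      (abs_le.1 (norm_le_pi_norm Y i)).2
    exact (mul_le_mul_of_nonneg_left h3 hc.le).trans h1
  obtain ⟨CG, hC, hCY⟩ := hup
  obtain ⟨cG, hc, hcY⟩ := hlow
  exact ⟨cG, CG, hc, hC, fun Y => ⟨hcY Y, hCY Y⟩⟩

theorem gNormSq_stacked_smul {X : Type*} [NormedAddCommGroup X] [InnerProductSpace ℝ X]
    {s : ℕ} (G : Matrix (Fin s) (Fin s) ℝ) {x : X} (hx : ‖x‖ = 1) (u : ℤ → ℝ) (n : ℤ) :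
    gNormSq G (stacked s (fun i => u i • x) n) = gNormSq G (stacked s u n) := by
  simp [gNormSq, stacked, sum_inner, smul_smul, inner_smul_left, inner_smul_right, hx,
    Finset.mul_sum, mul_left_comm]

/-- The summation assumption passes from the Hilbert space `X ≠ 0` to the real line, where
it telescopes. -/
theorem SummationAssumption.exists_scalar_energy {X : Type*} [NormedAddCommGroup X]
    [InnerProductSpace ℝ X] [Nontrivial X] {k δ : ℕ} (hk : 1 ≤ k) {ω η : ℝ}
    {G : ℝ → Matrix (Fin (k + δ)) (Fin (k + δ)) ℝ} {γ : ℝ → Fin (k + δ + 1) → ℝ}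
    (hsum : SummationAssumption X k δ ω η G γ) {μ : ℝ} (hμ : μ ∈ Set.Icc 0 ω) :
    ∃ cG CG : ℝ, 0 < cG ∧ 0 < CG ∧ ∀ τ : ℝ, 0 < τ → ∀ (y : ℤ → ℝ) (m N : ℕ), m ≤ N →
      cG * y N ^ 2 - CG * ∑ i ∈ Finset.range (k + δ), y (m - i) ^ 2
        ≤ ∑ n ∈ Finset.Ioc m N,
            delayedBdf k δ τ μ y n * (y n - η * y (n - 1)) := by
  obtain ⟨x, hx⟩ := exists_norm_eq X (zero_le_one' ℝ)
  have hx' : inner ℝ x x = (1 : ℝ) := by rw [real_inner_self_eq_norm_sq, hx]; norm_num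
  obtain ⟨cG, CG, hc, hC, hY⟩ := exists_gNormSq_bounds (hsum.posDef μ hμ)
  refine ⟨cG, CG, hc, hC, fun τ hτ y m N hmN => ?_⟩
  have hstep : ∀ n : ℤ, gNormSq (G μ) (stacked (k + δ) y n)
      - gNormSq (G μ) (stacked (k + δ) y (n - 1))
      ≤ delayedBdf k δ τ μ y n * (y n - η * y (n - 1)) := by
    intro n
    have h := hsum.summation μ hμ τ hτ (fun i => y i • x) n
    have h1 : τ • bdf k τ (fun i => y i • x) n
        + μ • discreteDelay δ (fun m => τ • bdf k τ (fun i => y i • x) m) n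
        = delayedBdf k δ τ μ y n • x :=
      (map_delayedBdf (LinearMap.toSpanSingleton ℝ X x) k δ τ μ y n).symm
    rw [h1, gNormSq_stacked_smul _ hx, gNormSq_stacked_smul _ hx, smul_smul, ← sub_smul,
      inner_smul_left, inner_smul_right, hx', mul_one] at h
    simp only [conj_trivial] at h
    rw [h]
    linarith [sq_nonneg ‖∑ i : Fin (k + δ + 1), γ μ i • y (n - (i : ℕ)) • x‖]
  have htel : ∀ N : ℕ, m ≤ N → gNormSq (G μ) (stacked (k + δ) y N)
      - gNormSq (G μ) (stacked (k + δ) y m)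
      ≤ ∑ n ∈ Finset.Ioc m N, delayedBdf k δ τ μ y n * (y n - η * y (n - 1)) := by
    intro N hN
    induction N, hN using Nat.le_induction with
    | base => simp
    | succ N hN ih =>
      have h := hstep ((N + 1 : ℕ) : ℤ)
      rw [show (((N + 1 : ℕ) : ℤ) - 1) = N by push_cast; ring] at h
      rw [← Finset.insert_Ioc_right_eq_Ioc_add_one hN, Finset.sum_insert (by simp)]
      rw [show (((N + 1 : ℕ) : ℤ) - 1) = N by push_cast; ring]
      linarith
  have h1 := (hY (stacked (k + δ) y N)).1 ⟨0, by omega⟩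
  have h2 := (hY (stacked (k + δ) y m)).2
  simp only [stacked, Nat.cast_zero, sub_zero] at h1 h2
  rw [Fin.sum_univ_eq_sum_range (fun i => y (m - i) ^ 2)] at h2
  exact (sub_le_sub h1 h2).trans (htel N hmN)

/-! ### Transfer to positive semidefinite forms -/

open scoped MatrixOrder Matrix.Norms.L2Operator in
/-- Any finite family of vectors has, with respect to a positive semidefinite symmetric form, the
Gram matrix of finitely many real sequences. -/
theorem exists_gram_sequences {H : Type*} [AddCommGroup H] [Module ℝ H]
    (s : H →ₗ[ℝ] H →ₗ[ℝ] ℝ) (hsymm : ∀ x y, s x y = s y x) (hpos : ∀ x, 0 ≤ s x x)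
    (S : Finset ℤ) (y : ℤ → H) (hy : ∀ i, i ∉ S → y i = 0) :
    ∃ v : S → ℤ → ℝ, ∀ i j, s (y i) (y j) = ∑ r, v r i * v r j := by
  let A : Matrix S S ℝ := Matrix.of fun i j => s (y i) (y j)
  have hA : A.PosSemidef := by
    refine Matrix.PosSemidef.of_dotProduct_mulVec_nonneg ?_ fun x => ?_
    · ext i j; simp [A, hsymm]
    · have h : star x ⬝ᵥ (A.mulVec x) = s (∑ i, x i • y i) (∑ i, x i • y i) := by
        simp only [map_sum, map_smul, LinearMap.sum_apply, LinearMap.smul_apply, smul_eq_mul,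
          dotProduct, Matrix.mulVec, A, Matrix.of_apply, star_trivial, Finset.mul_sum]
        rw [Finset.sum_comm]
        exact Finset.sum_congr rfl fun i _ => Finset.sum_congr rfl fun j _ => by
          rw [hsymm]; ring
      rw [h]; exact hpos _
  obtain ⟨B, hB⟩ := CStarAlgebra.nonneg_iff_eq_star_mul_self.1 hA.nonneg
  refine ⟨fun r i => if h : i ∈ S then B r ⟨i, h⟩ else 0, fun i j => ?_⟩
  by_cases hi : i ∈ S
  · by_cases hj : j ∈ S
    · have := congrFun (congrFun hB ⟨i, hi⟩) ⟨j, hj⟩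
      simpa [A, Matrix.mul_apply, hi, hj] using this
    · simp [hy j hj, hj]
  · simp [hy i hi, hi]

/-- A quadratic inequality in scalar sequences is a positive semidefiniteness statement and so
holds with the product of reals replaced by any positive semidefinite symmetric form. -/
theorem form_energy_of_scalar_energy {H : Type*} [AddCommGroup H] [Module ℝ H]
    (s : H →ₗ[ℝ] H →ₗ[ℝ] ℝ) (hsymm : ∀ x y, s x y = s y x) (hpos : ∀ x, 0 ≤ s x x)
    {k δ m N : ℕ} {τ μ η cG CG : ℝ} (hmN : m ≤ N)
    (hscal : ∀ y : ℤ → ℝ, cG * y N ^ 2 - CG * ∑ i ∈ Finset.range (k + δ), y (m - i) ^ 2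
        ≤ ∑ n ∈ Finset.Ioc m N, delayedBdf k δ τ μ y n * (y n - η * y (n - 1)))
    (y : ℤ → H) :
    cG * s (y N) (y N) - CG * ∑ i ∈ Finset.range (k + δ), s (y (m - i)) (y (m - i))
      ≤ ∑ n ∈ Finset.Ioc m N, s (delayedBdf k δ τ μ y n) (y n - η • y (n - 1)) := by
  -- only finitely many members of the sequence enter
  set S : Finset ℤ := Finset.Icc (m - (k + δ)) N
  set z : ℤ → H := fun i => if i ∈ S then y i else 0
  have hz : ∀ i : ℤ, m - (k + δ) ≤ i → i ≤ N → y i = z i := by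
    intro i h1 h2; simp only [z, S]; rw [if_pos (Finset.mem_Icc.2 ⟨h1, h2⟩)]
  obtain ⟨v, hv⟩ := exists_gram_sequences s hsymm hpos S z fun i hi => if_neg hi
  have hL : ∀ n ∈ Finset.Ioc m N, s (delayedBdf k δ τ μ y n) (y n - η • y (n - 1))
      = ∑ r, delayedBdf k δ τ μ (v r) n * (v r n - η * v r (n - 1)) := by
    intro n hn
    obtain ⟨h1, h2⟩ := Finset.mem_Ioc.1 hn
    have hD : ∀ j : ℤ, s (delayedBdf k δ τ μ z n) (z j)
        = ∑ r, delayedBdf k δ τ μ (v r) n * v r j := by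
      intro j
      have h3 := map_delayedBdf (s.flip (z j)) k δ τ μ z n
      simp only [LinearMap.flip_apply, hv] at h3
      have h4 := map_delayedBdf (∑ r, v r j • LinearMap.proj r : (S → ℝ) →ₗ[ℝ] ℝ) k δ τ μ
        (fun i r => v r i) n
      have h5 : ∀ r, delayedBdf k δ τ μ (fun i r => v r i) n r = delayedBdf k δ τ μ (v r) n :=
        fun r => map_delayedBdf (LinearMap.proj r : (S → ℝ) →ₗ[ℝ] ℝ) k δ τ μ (fun i r => v r i) n
      simp only [LinearMap.sum_apply, LinearMap.smul_apply, LinearMap.proj_apply, smul_eq_mul,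
        h5] at h4
      rw [h3]
      simpa only [mul_comm] using h4.symm
    rw [delayedBdf_congr fun i hi hi' => hz i (by omega) (by omega), hz n (by omega) (by omega),
      hz (n - 1) (by omega) (by omega), map_sub, map_smul, hD, hD, smul_eq_mul, Finset.mul_sum,
      ← Finset.sum_sub_distrib]
    exact Finset.sum_congr rfl fun r _ => by ring
  have hR : ∀ i ∈ Finset.range (k + δ), s (y (m - i)) (y (m - i)) = ∑ r, v r (m - i) ^ 2 := by
    intro i hi
    have := Finset.mem_range.1 hi
    rw [hz _ (by omega) (by omega), hv]
    exact Finset.sum_congr rfl fun r _ => by ring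
  rw [Finset.sum_congr rfl hL, Finset.sum_congr rfl hR, hz N (by omega) le_rfl, hv,
    Finset.sum_comm, Finset.sum_comm (s := Finset.Ioc m N), Finset.mul_sum, Finset.mul_sum,
    ← Finset.sum_sub_distrib]
  refine Finset.sum_le_sum fun r _ => ?_
  simpa only [pow_two] using hscal (v r)

/-! ### The forms of the elliptic-parabolic problem -/

namespace EllipticParabolic

section Forms

variable {κ : ProblemConstants} {V Q H : Type*}
  [NormedAddCommGroup V] [InnerProductSpace ℝ V]
  [NormedAddCommGroup Q] [InnerProductSpace ℝ Q]
  [NormedAddCommGroup H] [InnerProductSpace ℝ H]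
  (P : EllipticParabolic κ V Q H)

theorem norm_emb_sq_le (q : Q) : ‖P.emb q‖ ^ 2 ≤ κ.Cemb ^ 2 / κ.cb * P.b q q := by
  have hcb := κ.cb_pos
  calc ‖P.emb q‖ ^ 2 ≤ (κ.Cemb * ‖q‖) ^ 2 := pow_le_pow_left₀ (norm_nonneg _) (P.emb_bound q) 2
    _ = κ.Cemb ^ 2 / κ.cb * (κ.cb * ‖q‖ ^ 2) := by field_simp
    _ ≤ _ := by gcongr; exact P.b_elliptic q

theorem b_self_nonneg (q : Q) : 0 ≤ P.b q q :=
  (mul_nonneg κ.cb_pos.le (sq_nonneg _)).trans (P.b_elliptic q)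

theorem b_le_half_add (q q' : Q) : P.b q q' ≤ (P.b q q + P.b q' q') / 2 := by
  have h := P.b_self_nonneg (q - q')
  simp only [map_sub, sub_apply] at h
  rw [P.b_symm q' q] at h
  linarith

/-- The window of the energy inequality at the first step: by the exact history only the starting
values and `e^k` contribute. -/
theorem sum_window_le {k δ : ℕ} (hδ : 1 ≤ δ) {e : ℤ → H}
    (hzero : ∀ i : ℤ, -δ ≤ i → i < 0 → e i = 0) :
    ∑ i ∈ Finset.range (k + δ), P.c (e (k - i)) (e (k - i))
      ≤ κ.Cc * (‖e k‖ ^ 2 + ∑ i ∈ Finset.range k, ‖e i‖ ^ 2) := by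
  obtain ⟨d, rfl⟩ := Nat.exists_eq_add_of_le' hδ
  have h1 : ∀ i ∈ Finset.range (k + (d + 1)), P.c (e (k - i)) (e (k - i))
      ≤ κ.Cc * ‖e (k - i)‖ ^ 2 := fun i _ =>
    (le_abs_self _).trans ((P.c_bound _ _).trans_eq (by ring))
  refine (Finset.sum_le_sum h1).trans_eq ?_
  rw [← Finset.mul_sum, show k + (d + 1) = k + 1 + d by ring, Finset.sum_range_add,
    Finset.sum_range_succ', Finset.sum_eq_zero (s := Finset.range d), add_zero, add_comm]
  · congr 1
    rw [← Finset.sum_range_reflect (fun i => ‖e i‖ ^ 2)]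
    simp only [Nat.cast_zero, sub_zero]
    congr 1
    refine Finset.sum_congr rfl fun i hi => ?_
    have := Finset.mem_range.1 hi
    congr 3
    omega
  · intro i hi
    have := Finset.mem_range.1 hi
    rw [hzero _ (by push_cast; omega) (by push_cast; omega)]; simp

variable [CompleteSpace V]

theorem a_opA_symm (f : V →L[ℝ] ℝ) (w : V) : P.a (P.opA.symm f) w = f w :=
  DFunLike.congr_fun (P.opA.apply_symm_apply f) w

theorem opM_apply (p q : H) : P.opM p q = P.d (P.opA.symm (P.d.flip p)) q := rfl

theorem opM_eq_a (p q : H) :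
    P.opM p q = P.a (P.opA.symm (P.d.flip p)) (P.opA.symm (P.d.flip q)) := by
  rw [P.a_symm, P.a_opA_symm, P.opM_apply, ContinuousLinearMap.flip_apply]

theorem opM_symm (p q : H) : P.opM p q = P.opM q p := by
  rw [P.opM_eq_a, P.opM_eq_a, P.a_symm]

theorem opM_self_nonneg (p : H) : 0 ≤ P.opM p p := by
  rw [P.opM_eq_a]
  exact (mul_nonneg κ.ca_pos.le (sq_nonneg _)).trans (P.a_elliptic _)

/-- The bound of `M = D A⁻¹ D*`; only the upper bound of `d` is assumed, and replacing `u` by `-u`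
makes it two-sided. -/
theorem abs_opM_le (p q : H) : |P.opM p q| ≤ κ.Cd ^ 2 / κ.ca * ‖p‖ * ‖q‖ := by
  have hca := κ.ca_pos
  have hCd := κ.Cd_pos
  have habs : ∀ (u : V) (q : H), |P.d u q| ≤ κ.Cd * ‖u‖ * ‖q‖ := fun u q =>
    abs_le'.2 ⟨P.d_bound u q, by simpa using P.d_bound (-u) q⟩
  set v := P.opA.symm (P.d.flip p)
  have h1 : κ.ca * ‖v‖ ^ 2 ≤ κ.Cd * ‖v‖ * ‖p‖ := by
    refine (P.a_elliptic v).trans ?_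
    rw [P.a_opA_symm, ContinuousLinearMap.flip_apply]
    exact P.d_bound v p
  have hv : ‖v‖ ≤ κ.Cd / κ.ca * ‖p‖ := by
    rcases eq_or_lt_of_le (norm_nonneg v) with h0 | h0
    · rw [← h0]; positivity
    · rw [div_mul_eq_mul_div, le_div_iff₀ hca]
      nlinarith
  calc |P.opM p q| ≤ κ.Cd * ‖v‖ * ‖q‖ := habs v q
    _ ≤ κ.Cd * (κ.Cd / κ.ca * ‖p‖) * ‖q‖ := by gcongr
    _ = _ := by ring

theorem opM_self_le (p : H) : P.opM p p ≤ κ.coupling * P.c p p := by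
  have hca := κ.ca_pos
  have hcc := κ.cc_pos
  have hCd := κ.Cd_pos
  calc P.opM p p ≤ κ.Cd ^ 2 / κ.ca * ‖p‖ * ‖p‖ := (le_abs_self _).trans (P.abs_opM_le p p)
    _ = κ.coupling * (κ.cc * ‖p‖ ^ 2) := by
      rw [ProblemConstants.coupling]; field_simp
    _ ≤ κ.coupling * P.c p p := by
      refine mul_le_mul_of_nonneg_left (P.c_elliptic p) ?_
      rw [ProblemConstants.coupling]; positivity

/-- The functional `C BDF y^n + M Δ_δ BDF y^n` in `H*`, applied to `x`. -/
noncomputable def evolution (k δ : ℕ) (τ : ℝ) (y : ℤ → H) (n : ℤ) (x : H) : ℝ :=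
  P.c (bdf k τ y n) x + P.opM (discreteDelay δ (bdf k τ y) n) x

end Forms

end EllipticParabolic

/-- Since `0 ≤ M ≤ ω C`, the operators `C` and `M` split as `C = S₀ + S₁`, `M = ω S₁` with
`S₀ = C - ω⁻¹ M` and `S₁ = ω⁻¹ M` both positive semidefinite. Then
`C BDF + M Δ BDF = S₀ BDF + S₁ (BDF + ω Δ BDF)`, so the scalar energy inequalities for the two
parameters `μ = 0` and `μ = ω` suffice and no spectral calculus of `C⁻¹ M` is needed. -/
theorem SummationAssumption.exists_energy {X : Type*} [NormedAddCommGroup X]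
    [InnerProductSpace ℝ X] [Nontrivial X] {k δ : ℕ} (hk : 1 ≤ k) {κ : ProblemConstants} {η : ℝ}
    {G : ℝ → Matrix (Fin (k + δ)) (Fin (k + δ)) ℝ} {γ : ℝ → Fin (k + δ + 1) → ℝ}
    (hsum : SummationAssumption X k δ κ.coupling η G γ) :
    ∃ cG CG : ℝ, 0 < cG ∧ 0 < CG ∧
      ∀ (V Q H : Type*)
        [NormedAddCommGroup V] [InnerProductSpace ℝ V] [CompleteSpace V]
        [NormedAddCommGroup Q] [InnerProductSpace ℝ Q]
        [NormedAddCommGroup H] [InnerProductSpace ℝ H]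
        (P : EllipticParabolic κ V Q H) (τ : ℝ) (_ : 0 < τ) (y : ℤ → H) (m N : ℕ) (_ : m ≤ N),
        cG * P.c (y N) (y N) - CG * ∑ i ∈ Finset.range (k + δ), P.c (y (m - i)) (y (m - i))
          ≤ τ * ∑ n ∈ Finset.Ioc m N, P.evolution k δ τ y n (y n - η • y (n - 1)) := by
  have hω : 0 < κ.coupling := by
    have := κ.ca_pos
    have := κ.cc_pos
    have := κ.Cd_pos
    rw [ProblemConstants.coupling]; positivity
  obtain ⟨c₀, C₀, hc₀, hC₀, h₀⟩ := hsum.exists_scalar_energy hk (μ := 0) ⟨le_rfl, hω.le⟩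
  obtain ⟨c₁, C₁, hc₁, hC₁, h₁⟩ := hsum.exists_scalar_energy hk (μ := κ.coupling) ⟨hω.le, le_rfl⟩
  refine ⟨min c₀ c₁, max C₀ C₁, lt_min hc₀ hc₁, lt_max_of_lt_left hC₀, ?_⟩
  intro V Q H _ _ _ _ _ _ _ P τ hτ y m N hmN
  let S₁ : H →ₗ[ℝ] H →ₗ[ℝ] ℝ :=
    κ.coupling⁻¹ • (ContinuousLinearMap.coeLM ℝ ∘ₗ (P.opM : H →ₗ[ℝ] H →L[ℝ] ℝ))
  let S₀ : H →ₗ[ℝ] H →ₗ[ℝ] ℝ :=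
    ContinuousLinearMap.coeLM ℝ ∘ₗ (P.c : H →ₗ[ℝ] H →L[ℝ] ℝ) - S₁
  have e₁ : ∀ x z, S₁ x z = κ.coupling⁻¹ * P.opM x z := fun x z => rfl
  have e₀ : ∀ x z, S₀ x z = P.c x z - κ.coupling⁻¹ * P.opM x z := fun x z => rfl
  have hp₁ : ∀ x, 0 ≤ S₁ x x := fun x => by
    rw [e₁]; exact mul_nonneg (inv_nonneg.2 hω.le) (P.opM_self_nonneg x)
  have hp₀ : ∀ x, 0 ≤ S₀ x x := fun x => by
    rw [e₀, sub_nonneg, inv_mul_le_iff₀ hω]; exact P.opM_self_le x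
  have E₀ := form_energy_of_scalar_energy S₀ (fun x z => by rw [e₀, e₀, P.c_symm, P.opM_symm]) hp₀
    hmN (fun u => h₀ τ hτ u m N hmN) y
  have E₁ := form_energy_of_scalar_energy S₁ (fun x z => by rw [e₁, e₁, P.opM_symm]) hp₁
    hmN (fun u => h₁ τ hτ u m N hmN) y
  have hright : ∑ n ∈ Finset.Ioc m N, S₀ (delayedBdf k δ τ 0 y n) (y n - η • y (n - 1))
      + ∑ n ∈ Finset.Ioc m N, S₁ (delayedBdf k δ τ κ.coupling y n) (y n - η • y (n - 1))
      = τ * ∑ n ∈ Finset.Ioc m N, P.evolution k δ τ y n (y n - η • y (n - 1)) := by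
    rw [← Finset.sum_add_distrib, Finset.mul_sum]
    refine Finset.sum_congr rfl fun n _ => ?_
    simp only [e₀, e₁, delayedBdf, EllipticParabolic.evolution, discreteDelay_smul]
    generalize y n - η • y (n - 1) = z
    simp only [zero_smul, add_zero, map_add, map_smul, add_apply,
      smul_apply, smul_eq_mul]
    field_simp
    ring
  have hwin : ∀ s : H →ₗ[ℝ] H →ₗ[ℝ] ℝ, (∀ x, 0 ≤ s x x) →
      0 ≤ ∑ i ∈ Finset.range (k + δ), s (y (m - i)) (y (m - i)) :=
    fun s hs => Finset.sum_nonneg fun i _ => hs _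
  have hwsum : ∑ i ∈ Finset.range (k + δ), P.c (y (m - i)) (y (m - i))
      = ∑ i ∈ Finset.range (k + δ), S₀ (y (m - i)) (y (m - i))
        + ∑ i ∈ Finset.range (k + δ), S₁ (y (m - i)) (y (m - i)) := by
    rw [← Finset.sum_add_distrib]
    exact Finset.sum_congr rfl fun i _ => by rw [e₀, e₁]; ring
  have hN : P.c (y N) (y N) = S₀ (y N) (y N) + S₁ (y N) (y N) := by rw [e₀, e₁]; ring
  rw [hwsum, hN, ← hright]
  have a1 := mul_le_mul_of_nonneg_right (min_le_left c₀ c₁) (hp₀ (y N))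
  have a2 := mul_le_mul_of_nonneg_right (min_le_right c₀ c₁) (hp₁ (y N))
  have a3 := mul_le_mul_of_nonneg_right (le_max_left C₀ C₁) (hwin S₀ hp₀)
  have a4 := mul_le_mul_of_nonneg_right (le_max_right C₀ C₁) (hwin S₁ hp₁)
  linarith

/-! ### The error equation -/

theorem norm_bdf_le {E : Type*} [NormedAddCommGroup E] [NormedSpace ℝ E] {k : ℕ} {τ : ℝ}
    {y : ℤ → E} {n : ℤ} {σ : ℝ} (h : ∀ i, n - k ≤ i → i ≤ n → ‖y i‖ ≤ σ) :
    ‖bdf k τ y n‖ ≤ |τ⁻¹| * ((∑ l ∈ Finset.range (k + 1), |bdfCoeff k l|) * σ) := by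
  rw [bdf, norm_smul, Real.norm_eq_abs, Finset.sum_mul]
  refine mul_le_mul_of_nonneg_left ((norm_sum_le _ _).trans
    (Finset.sum_le_sum fun l hl => ?_)) (abs_nonneg _)
  have := Finset.mem_range.1 hl
  rw [norm_smul, Real.norm_eq_abs]
  exact mul_le_mul_of_nonneg_left (h _ (by omega) (by omega)) (abs_nonneg _)

theorem norm_discreteDelay_le {E : Type*} [NormedAddCommGroup E] [NormedSpace ℝ E] {δ : ℕ}
    {y : ℤ → E} {n : ℤ} {σ : ℝ} (h : ∀ i, n - δ ≤ i → i < n → ‖y i‖ ≤ σ) :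
    ‖discreteDelay δ y n‖ ≤ (∑ l ∈ Finset.Icc 1 δ, |delayCoeff δ l|) * σ := by
  rw [discreteDelay, Finset.sum_mul]
  refine (norm_sum_le _ _).trans (Finset.sum_le_sum fun l hl => ?_)
  have := Finset.mem_Icc.1 hl
  rw [norm_smul, Real.norm_eq_abs]
  exact mul_le_mul_of_nonneg_left (h _ (by omega) (by omega)) (abs_nonneg _)

/-- A bound for the norm of `C x + M ∑ c_{δ,ℓ} z_ℓ` with `x` and all `z_ℓ` in the unit ball. -/
noncomputable def ProblemConstants.evolutionConst (κ : ProblemConstants) (δ : ℕ) : ℝ :=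
  κ.Cc + κ.Cd ^ 2 / κ.ca * ∑ l ∈ Finset.Icc 1 δ, |delayCoeff δ l|

theorem ProblemConstants.evolutionConst_pos (κ : ProblemConstants) (δ : ℕ) :
    0 < κ.evolutionConst δ := by
  have := κ.ca_pos
  have := κ.Cc_pos
  rw [evolutionConst]; positivity

namespace EllipticParabolic

section Error

variable {κ : ProblemConstants} {V Q H : Type*}
  [NormedAddCommGroup V] [InnerProductSpace ℝ V] [CompleteSpace V]
  [NormedAddCommGroup Q] [InnerProductSpace ℝ Q]
  [NormedAddCommGroup H] [InnerProductSpace ℝ H]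
  (P : EllipticParabolic κ V Q H)

theorem abs_c_add_opM_le {x z v : H} {σ : ℝ} {δ : ℕ} (hx : ‖x‖ ≤ σ)
    (hz : ‖z‖ ≤ (∑ l ∈ Finset.Icc 1 δ, |delayCoeff δ l|) * σ) :
    |P.c x v + P.opM z v| ≤ κ.evolutionConst δ * σ * ‖v‖ := by
  have := κ.ca_pos
  have := κ.Cc_pos
  have := κ.Cd_pos
  calc |P.c x v + P.opM z v| ≤ κ.Cc * ‖x‖ * ‖v‖ + κ.Cd ^ 2 / κ.ca * ‖z‖ * ‖v‖ :=
        (abs_add_le _ _).trans (add_le_add (P.c_bound x v) (P.abs_opM_le z v))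
    _ ≤ κ.Cc * σ * ‖v‖
        + κ.Cd ^ 2 / κ.ca * ((∑ l ∈ Finset.Icc 1 δ, |delayCoeff δ l|) * σ) * ‖v‖ := by gcongr
    _ = _ := by rw [ProblemConstants.evolutionConst]; ring

/-- The error satisfies the scheme up to a defect of order `τ^k`. -/
theorem exists_error_equation {k δ : ℕ} (hk : 1 ≤ k) {K : NNReal} {τ T : ℝ} (hτ : 0 < τ)
    {r : ℝ → (Q →L[ℝ] ℝ)} {pbar : ℝ → H} {p : ℤ → H}
    (hreg : HasSobolevBound k K (-(δ * τ)) T pbar) (hpbar : P.IsDelaySolution δ τ T r pbar)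
    (hp : P.IsBDFSolution k δ τ T r p) {n : ℕ} (hkn : k ≤ n) (hn : n * τ ≤ T) :
    ∃ w : Q, P.emb w = p n - pbar (n * τ) ∧ ∀ q : Q,
      P.evolution k δ τ (fun i => p i - pbar (i * τ)) n (P.emb q) + P.b w q
        ≤ κ.evolutionConst δ * (K * bdfErrorConst k) * τ ^ k * ‖P.emb q‖ := by
  have hn0 : (0 : ℝ) < n := by exact_mod_cast (by omega : 0 < n)
  obtain ⟨w₁, hw₁, h₁⟩ := hp n hkn hn
  obtain ⟨w₂, hw₂, h₂⟩ := hpbar (n * τ) ⟨by positivity, hn⟩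
  refine ⟨w₁ - w₂, by rw [map_sub, hw₁, hw₂], fun q => ?_⟩
  set g : ℤ → H := fun i => pbar (i * τ)
  set D : ℤ → H := fun i => derivWithin pbar (Set.Icc (-(δ * τ)) T) (i * τ)
  have hres : ∀ i : ℤ, (n : ℤ) - δ ≤ i → i ≤ n →
      ‖bdf k τ g i - D i‖ ≤ K * bdfErrorConst k * τ ^ k := by
    intro i hi hi'
    have e1 : (-δ : ℝ) ≤ i - k := by
      have : (-δ : ℤ) ≤ i - k := by omega
      exact_mod_cast this
    have e2 : (i : ℝ) ≤ n := by exact_mod_cast hi'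
    exact norm_bdf_sub_derivWithin_le hk hτ hreg (by nlinarith) (by nlinarith)
  have hD : ∑ l ∈ Finset.Icc 1 δ,
      delayCoeff δ l • derivWithin pbar (Set.Icc (-(δ * τ)) T) (n * τ - l * τ)
      = discreteDelay δ D n := by
    refine Finset.sum_congr rfl fun l _ => ?_
    simp only [D]
    congr 3
    push_cast; ring
  have hbound := P.abs_c_add_opM_le (v := P.emb q) (δ := δ) (hres n (by omega) le_rfl)
    (norm_discreteDelay_le (y := fun i => bdf k τ g i - D i) (n := n)
      fun i hi hi' => hres i hi hi'.le)
  rw [discreteDelay_sub] at hbound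
  have h₁q := h₁ q
  have h₂q := h₂ q
  rw [hD] at h₂q
  have hDn : derivWithin pbar (Set.Icc (-(δ * τ)) T) (n * τ) = D n := by simp [D]
  rw [hDn] at h₂q
  have hlin : P.evolution k δ τ (fun i => p i - pbar (i * τ)) n (P.emb q) + P.b (w₁ - w₂) q
      = -(P.c (bdf k τ g n - D n) (P.emb q)
        + P.opM (discreteDelay δ (bdf k τ g) n - discreteDelay δ D n) (P.emb q)) := by
    have e : bdf k τ (fun i => p i - pbar (i * τ)) = fun i => bdf k τ p i - bdf k τ g i :=
      funext fun i => bdf_sub k τ p g i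
    rw [evolution, e, discreteDelay_sub]
    simp only [map_sub, sub_apply]
    linarith
  rw [hlin]
  calc _ ≤ κ.evolutionConst δ * (K * bdfErrorConst k * τ ^ k) * ‖P.emb q‖ :=
        (neg_le_abs _).trans hbound
    _ = _ := by ring

/-! ### Stability -/

/-- The first step. The previous value need not lie in `Q`, which excludes the multiplier
`e^k - η e^{k-1}`; the test function is `e^k` itself, and positivity of the leading coefficient of
the BDF method is enough. -/
theorem first_step_bound {k δ : ℕ} (hk : 1 ≤ k) {τ θ σ : ℝ} (hτ : 0 < τ) {e : ℤ → H}
    (hσ : ∀ i : ℤ, -δ ≤ i → i < k → ‖e i‖ ≤ σ) {w : Q} (hw : P.emb w = e k)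
    (herr : P.evolution k δ τ e k (P.emb w) + P.b w w ≤ θ * ‖P.emb w‖) :
    κ.cc / 2 * ‖e k‖ ^ 2 + τ * P.b w w
      ≤ ((κ.evolutionConst δ * (∑ l ∈ Finset.range (k + 1), |bdfCoeff k l|)) ^ 2 * σ ^ 2
        + τ ^ 2 * θ ^ 2) / κ.cc := by
  have hcc := κ.cc_pos
  set L := ∑ l ∈ Finset.range (k + 1), |bdfCoeff k l|
  set A := κ.evolutionConst δ * L
  rw [hw] at herr
  -- `y` agrees with `e` except that its value at `k` is zero
  set y : ℤ → H := fun i => if i = k then 0 else e i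
  have hy : ∀ i : ℤ, -δ ≤ i → i ≤ k → ‖y i‖ ≤ σ := by
    intro i hi hi'
    by_cases h : i = k
    · have : 0 ≤ σ := (norm_nonneg _).trans (hσ (k - 1) (by omega) (by omega))
      simpa [y, h] using this
    · simpa [y, h] using hσ i hi (by omega)
  have hbdf : bdf k τ e k = (τ⁻¹ * bdfCoeff k 0) • e k + bdf k τ y k := by
    rw [bdf, bdf, Finset.sum_range_succ', Finset.sum_range_succ']
    have : ∀ l ∈ Finset.range k, bdfCoeff k (l + 1) • e (k - (l + 1 : ℕ))
        = bdfCoeff k (l + 1) • y (k - (l + 1 : ℕ)) := by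
      intro l _
      simp only [y]
      rw [if_neg (by omega)]
    rw [Finset.sum_congr rfl this]
    simp [y, smul_smul, add_comm]
  have hdel : discreteDelay δ (bdf k τ e) k = discreteDelay δ (bdf k τ y) k := by
    refine Finset.sum_congr rfl fun l hl => ?_
    have := Finset.mem_Icc.1 hl
    rw [bdf_congr fun i _ hi => ?_]
    simp only [y]
    rw [if_neg (by omega)]
  have hτi : |τ⁻¹| = τ⁻¹ := abs_of_pos (inv_pos.2 hτ)
  have hrest := P.abs_c_add_opM_le (v := e k) (δ := δ)
    (norm_bdf_le (τ := τ) (n := k) (k := k) fun i hi hi' => hy i (by omega) hi')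
    (norm_discreteDelay_le (y := bdf k τ y) (n := k) fun i hi hi' =>
      norm_bdf_le (τ := τ) fun j hj hj' => hy j (by omega) (by omega))
  rw [hτi] at hrest
  have hev : P.evolution k δ τ e k (e k) = τ⁻¹ * bdfCoeff k 0 * P.c (e k) (e k)
      + (P.c (bdf k τ y k) (e k) + P.opM (discreteDelay δ (bdf k τ y) k) (e k)) := by
    rw [evolution, hdel, hbdf]
    simp only [map_add, map_smul, add_apply, smul_apply,
      smul_eq_mul]
    ring
  have hell : κ.cc * ‖e k‖ ^ 2 ≤ bdfCoeff k 0 * P.c (e k) (e k) := by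
    have h1 := P.c_elliptic (e k)
    have h0 : 0 ≤ κ.cc * ‖e k‖ ^ 2 := by positivity
    nlinarith [one_le_bdfCoeff_zero hk]
  have hmain : κ.cc * ‖e k‖ ^ 2 + τ * P.b w w ≤ A * σ * ‖e k‖ + τ * θ * ‖e k‖ := by
    have h1 := (abs_le.1 hrest).1
    have h2 : τ⁻¹ * bdfCoeff k 0 * P.c (e k) (e k)
        - κ.evolutionConst δ * (τ⁻¹ * (L * σ)) * ‖e k‖ + P.b w w ≤ θ * ‖e k‖ := by
      linarith
    have h3 := mul_le_mul_of_nonneg_left h2 hτ.le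
    have h4 : τ * (τ⁻¹ * bdfCoeff k 0 * P.c (e k) (e k)
        - κ.evolutionConst δ * (τ⁻¹ * (L * σ)) * ‖e k‖ + P.b w w)
        = bdfCoeff k 0 * P.c (e k) (e k) - A * σ * ‖e k‖ + τ * P.b w w := by
      simp only [A]; field_simp
    rw [h4] at h3
    linarith
  have y1 : A * σ * ‖e k‖ ≤ κ.cc / 4 * ‖e k‖ ^ 2 + A ^ 2 * σ ^ 2 / κ.cc := by
    rw [← sub_nonneg]
    have h : κ.cc / 4 * ‖e k‖ ^ 2 + A ^ 2 * σ ^ 2 / κ.cc - A * σ * ‖e k‖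
      = (κ.cc / 2 * ‖e k‖ - A * σ) ^ 2 / κ.cc := by field_simp; ring
    rw [h]; positivity
  have y2 : τ * θ * ‖e k‖ ≤ κ.cc / 4 * ‖e k‖ ^ 2 + τ ^ 2 * θ ^ 2 / κ.cc := by
    rw [← sub_nonneg]
    have h : κ.cc / 4 * ‖e k‖ ^ 2 + τ ^ 2 * θ ^ 2 / κ.cc - τ * θ * ‖e k‖
      = (κ.cc / 2 * ‖e k‖ - τ * θ) ^ 2 / κ.cc := by field_simp; ring
    rw [h]; positivity
  rw [add_div]
  linarith

/-- Testing with `e^n - η e^{n-1}`: ellipticity of `b` absorbs the defect because `η < 1`, and the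
remaining energies `b(e^n, e^n)` telescope. -/
theorem sum_evolution_add_sum_b_le {k δ N : ℕ} {τ θ η : ℝ} (hτ : 0 < τ) (hθ : 0 ≤ θ)
    (hη : 0 ≤ η) (hη' : η < 1) {e : ℤ → H} {w : ℕ → Q}
    (hw : ∀ n, k ≤ n → n ≤ N → P.emb (w n) = e n)
    (herr : ∀ n, k ≤ n → n ≤ N → ∀ q,
      P.evolution k δ τ e n (P.emb q) + P.b (w n) q ≤ θ * ‖P.emb q‖) (hkN : k ≤ N) :
    τ * ∑ n ∈ Finset.Ioc k N, P.evolution k δ τ e n (e n - η • e (n - 1))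
        + (1 - η) / 4 * (τ * ∑ n ∈ Finset.Ioc k N, P.b (w n) (w n))
      ≤ τ / 2 * P.b (w k) (w k)
        + N * τ * (2 * (κ.Cemb ^ 2 / κ.cb) / (1 - η) * θ ^ 2) := by
  set β := κ.Cemb ^ 2 / κ.cb
  have hβ : 0 < β := div_pos (pow_pos κ.Cemb_pos 2) κ.cb_pos
  have hν : 0 < 1 - η := by linarith
  -- Young's inequality with a weight that consumes half of the dissipation `(1 - η) / 2 * b`
  have hyoung : ∀ n, k ≤ n → n ≤ N →
      θ * ‖e n‖ ≤ (1 - η) / 4 * P.b (w n) (w n) + β / (1 - η) * θ ^ 2 := by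
    intro n h1 h2
    have h3 := P.norm_emb_sq_le (w n)
    rw [hw n h1 h2] at h3
    have h4 : θ * ‖e n‖ ≤ (1 - η) / 4 * (‖e n‖ ^ 2 / β) + β / (1 - η) * θ ^ 2 := by
      rw [← sub_nonneg]
      have h : (1 - η) / 4 * (‖e n‖ ^ 2 / β) + β / (1 - η) * θ ^ 2 - θ * ‖e n‖
          = ((1 - η) / 2 * ‖e n‖ - β * θ) ^ 2 / ((1 - η) * β) := by field_simp; ring
      rw [h]; positivity
    have h5 : ‖e n‖ ^ 2 / β ≤ P.b (w n) (w n) := by rw [div_le_iff₀ hβ]; linarith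
    have h6 := mul_le_mul_of_nonneg_left h5 (show 0 ≤ (1 - η) / 4 by linarith)
    linarith
  have hstep : ∀ n, k ≤ n → n + 1 ≤ N →
      P.evolution k δ τ e (n + 1 : ℕ) (e (n + 1 : ℕ) - η • e ((n + 1 : ℕ) - 1))
        + (1 - η) / 4 * P.b (w (n + 1)) (w (n + 1))
        + (P.b (w (n + 1)) (w (n + 1)) - P.b (w n) (w n)) / 2
      ≤ 2 * β / (1 - η) * θ ^ 2 := by
    intro n h1 h2
    have hc : ((n + 1 : ℕ) : ℤ) - 1 = n := by push_cast; ring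
    have h := herr (n + 1) (by omega) h2 (w (n + 1) - η • w n)
    rw [map_sub, map_smul, hw (n + 1) (by omega) h2, hw n h1 (by omega), map_sub, map_smul,
      smul_eq_mul] at h
    have hz : ‖e (n + 1 : ℕ) - η • e n‖ ≤ ‖e (n + 1 : ℕ)‖ + ‖e n‖ := by
      refine (norm_sub_le _ _).trans ?_
      rw [norm_smul, Real.norm_of_nonneg hη]
      nlinarith [norm_nonneg (e n)]
    have hz' := mul_le_mul_of_nonneg_left hz hθ
    have y1 := hyoung (n + 1) (by omega) h2
    have y2 := hyoung n h1 (by omega)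
    have hb := mul_le_mul_of_nonneg_left (P.b_le_half_add (w (n + 1)) (w n)) hη
    have hb0 := mul_nonneg hν.le (P.b_self_nonneg (w n))
    have e1 : 2 * β / (1 - η) * θ ^ 2 = β / (1 - η) * θ ^ 2 + β / (1 - η) * θ ^ 2 := by ring
    rw [hc, e1]
    linarith
  have hind : ∀ M, k ≤ M → M ≤ N →
      τ * ∑ n ∈ Finset.Ioc k M, P.evolution k δ τ e n (e n - η • e (n - 1))
        + (1 - η) / 4 * (τ * ∑ n ∈ Finset.Ioc k M, P.b (w n) (w n))
        + τ / 2 * P.b (w M) (w M)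
      ≤ τ / 2 * P.b (w k) (w k) + M * τ * (2 * β / (1 - η) * θ ^ 2) := by
    intro M hM
    induction M, hM using Nat.le_induction with
    | base =>
      intro _
      have : 0 ≤ k * τ * (2 * β / (1 - η) * θ ^ 2) := by positivity
      simpa using this
    | succ M hM ih =>
      intro hMN
      have h1 := ih (by omega)
      have h2 := mul_le_mul_of_nonneg_left (hstep M hM hMN) hτ.le
      rw [← Finset.insert_Ioc_right_eq_Ioc_add_one hM, Finset.sum_insert (by simp),
        Finset.sum_insert (by simp)]
      push_cast at h2 ⊢
      linarith
  have h1 := hind N hkN le_rfl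
  have h2 : 0 ≤ τ / 2 * P.b (w N) (w N) := mul_nonneg (by linarith) (P.b_self_nonneg _)
  linarith

end Error

end EllipticParabolic

/-! ### Convergence -/

/-- Stability of the error equation: a defect of size `D τ^k` and arbitrary starting values
contribute to the error with the orders claimed. -/
theorem SummationAssumption.exists_stability {X : Type*} [NormedAddCommGroup X]
    [InnerProductSpace ℝ X] [Nontrivial X] {k δ : ℕ} (hk : 1 ≤ k) (hδ : 1 ≤ δ)
    {κ : ProblemConstants} {η : ℝ}
    {G : ℝ → Matrix (Fin (k + δ)) (Fin (k + δ)) ℝ} {γ : ℝ → Fin (k + δ + 1) → ℝ}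
    (hsum : SummationAssumption X k δ κ.coupling η G γ) {T D : ℝ} (hT : 0 < T) (hD : 0 ≤ D) :
    ∃ C : ℝ, 0 < C ∧
      ∀ (V Q H : Type*)
        [NormedAddCommGroup V] [InnerProductSpace ℝ V] [CompleteSpace V]
        [NormedAddCommGroup Q] [InnerProductSpace ℝ Q]
        [NormedAddCommGroup H] [InnerProductSpace ℝ H]
        (P : EllipticParabolic κ V Q H) (τ : ℝ) (_ : 0 < τ) (e : ℤ → H) (N : ℕ) (_ : k ≤ N)
        (_ : N * τ ≤ T) (_ : ∀ i : ℤ, -δ ≤ i → i < 0 → e i = 0)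
        (_ : ∀ n : ℕ, k ≤ n → n ≤ N → ∃ w : Q, P.emb w = e n ∧ ∀ q : Q,
          P.evolution k δ τ e n (P.emb q) + P.b w q ≤ D * τ ^ k * ‖P.emb q‖),
        ‖e N‖ ^ 2 + τ * ∑ l ∈ Finset.Icc k N, ‖e l‖ ^ 2
          ≤ C * (τ ^ (2 * k) + ∑ l ∈ Finset.range k, ‖e l‖ ^ 2) := by
  obtain ⟨cG, CG, hcG, hCG, henergy⟩ := hsum.exists_energy hk
  have hη := hsum.eta_nonneg
  have hν : 0 < 1 - η := by linarith [hsum.eta_lt_one]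
  have hcc := κ.cc_pos
  have hCc := κ.Cc_pos
  have hβ : 0 < κ.Cemb ^ 2 / κ.cb := div_pos (pow_pos κ.Cemb_pos 2) κ.cb_pos
  have hk0 : (1 : ℝ) ≤ k := by exact_mod_cast hk
  obtain ⟨A, hA⟩ : ∃ A, κ.evolutionConst δ * ∑ l ∈ Finset.range (k + 1), |bdfCoeff k l| = A :=
    ⟨_, rfl⟩
  obtain ⟨β, hβdef⟩ : ∃ β, κ.Cemb ^ 2 / κ.cb = β := ⟨_, rfl⟩
  rw [hβdef] at hβ
  -- `C₂` bounds the first step, `C₃` the energy estimate of all later steps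
  obtain ⟨C₂, hC₂def⟩ : ∃ C₂, C₂ = (A ^ 2 + T ^ 2 * D ^ 2) / κ.cc := ⟨_, rfl⟩
  have hC₂ : 0 ≤ C₂ := by rw [hC₂def]; positivity
  obtain ⟨C₃, hC₃def⟩ : ∃ C₃, C₃ = CG * (κ.Cc * (2 * C₂ / κ.cc + 1)) + C₂
    + T * (2 * β / (1 - η) * D ^ 2) := ⟨_, rfl⟩
  have hC₃ : 0 ≤ C₃ := by rw [hC₃def]; positivity
  refine ⟨1 + (C₃ / (cG * κ.cc) + β * (C₂ + 4 * C₃ / (1 - η))), by positivity, ?_⟩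
  intro V Q H _ _ _ _ _ _ _ P τ hτ e N hkN hN hzero herr
  obtain ⟨S, hS⟩ : ∃ S, ∑ l ∈ Finset.range k, ‖e l‖ ^ 2 = S := ⟨_, rfl⟩
  have hS0 : 0 ≤ S := hS ▸ Finset.sum_nonneg fun _ _ => sq_nonneg _
  rw [hS]
  have hτk : 0 < τ ^ (2 * k) := by positivity
  obtain ⟨R, hR⟩ : ∃ R, R = τ ^ (2 * k) + S := ⟨_, rfl⟩
  have hR0 : 0 ≤ R := by linarith
  rw [← hR]
  have hNr : (k : ℝ) ≤ N := by exact_mod_cast hkN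
  -- at least one step fits into `[0, T]`, so the step size is bounded
  have hτT : τ ≤ T := (le_mul_of_one_le_left hτ.le (hk0.trans hNr)).trans hN
  choose! w hw herr using herr
  have hσ : ∀ i : ℤ, -δ ≤ i → i < k → ‖e i‖ ≤ √S := by
    intro i h1 h2
    rcases lt_or_ge i 0 with h | h
    · rw [hzero i h1 h, norm_zero]; positivity
    · lift i to ℕ using h
      refine Real.le_sqrt_of_sq_le (hS ▸ ?_)
      exact Finset.single_le_sum (f := fun i : ℕ => ‖e i‖ ^ 2) (fun _ _ => sq_nonneg _)
        (Finset.mem_range.2 (by omega))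
  have hfirst := P.first_step_bound hk hτ hσ (hw k le_rfl hkN) (herr k le_rfl hkN (w k))
  have hbk := mul_nonneg hτ.le (P.b_self_nonneg (w k))
  have hDτ : (D * τ ^ k) ^ 2 = D ^ 2 * τ ^ (2 * k) := by rw [mul_pow, ← pow_mul, mul_comm k 2]
  rw [hA, Real.sq_sqrt hS0, hDτ] at hfirst
  have hfirst' : κ.cc / 2 * ‖e k‖ ^ 2 + τ * P.b (w k) (w k) ≤ C₂ * R := by
    refine hfirst.trans ?_
    rw [hC₂def, div_mul_eq_mul_div]
    refine div_le_div_of_nonneg_right ?_ hcc.le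
    have h1 : τ ^ 2 ≤ T ^ 2 := pow_le_pow_left₀ hτ.le hτT 2
    have h2 : τ ^ 2 * (D ^ 2 * τ ^ (2 * k)) ≤ T ^ 2 * (D ^ 2 * τ ^ (2 * k)) := by gcongr
    have h3 : 0 ≤ A ^ 2 * τ ^ (2 * k) := by positivity
    have h4 : 0 ≤ T ^ 2 * D ^ 2 * S := by positivity
    rw [hR]
    linarith
  have hek : ‖e k‖ ^ 2 ≤ 2 * C₂ / κ.cc * R := by
    rw [div_mul_eq_mul_div, le_div_iff₀ hcc]; linarith
  have hek0 : 0 ≤ κ.cc / 2 * ‖e k‖ ^ 2 := by positivity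
  have hE := henergy V Q H P τ hτ e k N hkN
  have hW := mul_le_mul_of_nonneg_left (P.sum_window_le (k := k) hδ hzero) hCG.le
  have hB := P.sum_evolution_add_sum_b_le hτ (mul_nonneg hD (pow_nonneg hτ.le k)) hη
    hsum.eta_lt_one hw herr hkN
  rw [hDτ, hβdef] at hB
  rw [hS] at hW
  obtain ⟨B, hBdef⟩ : ∃ B, ∑ n ∈ Finset.Ioc k N, P.b (w n) (w n) = B := ⟨_, rfl⟩
  rw [hBdef] at hB
  have hB0 : 0 ≤ B := hBdef ▸ Finset.sum_nonneg fun _ _ => P.b_self_nonneg _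
  have hmain : cG * κ.cc * ‖e N‖ ^ 2 + (1 - η) / 4 * (τ * B) ≤ C₃ * R := by
    have h1 := mul_le_mul_of_nonneg_left (P.c_elliptic (e N)) hcG.le
    have h2 : N * τ * (2 * β / (1 - η) * (D ^ 2 * τ ^ (2 * k)))
        ≤ T * (2 * β / (1 - η) * D ^ 2) * R := by
      calc N * τ * (2 * β / (1 - η) * (D ^ 2 * τ ^ (2 * k)))
          ≤ T * (2 * β / (1 - η) * (D ^ 2 * R)) := by
            gcongr; linarith
        _ = _ := by ring
    have h3 : CG * (κ.Cc * (‖e k‖ ^ 2 + S)) ≤ CG * (κ.Cc * (2 * C₂ / κ.cc + 1)) * R := by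
      calc CG * (κ.Cc * (‖e k‖ ^ 2 + S)) ≤ CG * (κ.Cc * (2 * C₂ / κ.cc * R + R)) := by
            gcongr; linarith
        _ = _ := by ring
    rw [hC₃def]
    linarith
  have hτB : 0 ≤ (1 - η) / 4 * (τ * B) := by positivity
  have hN1 : ‖e N‖ ^ 2 ≤ C₃ / (cG * κ.cc) * R := by
    rw [div_mul_eq_mul_div, le_div_iff₀ (by positivity)]; linarith
  have hB1 : τ * B ≤ 4 * C₃ / (1 - η) * R := by
    have : 0 ≤ cG * κ.cc * ‖e N‖ ^ 2 := by positivity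
    rw [div_mul_eq_mul_div, le_div_iff₀ hν]; linarith
  have hQ : ∑ l ∈ Finset.Icc k N, ‖e l‖ ^ 2 ≤ β * (P.b (w k) (w k) + B) := by
    rw [← hBdef, Finset.add_sum_Ioc_eq_sum_Icc (f := fun n => P.b (w n) (w n)) hkN, Finset.mul_sum]
    refine Finset.sum_le_sum fun n hn => ?_
    obtain ⟨h1, h2⟩ := Finset.mem_Icc.1 hn
    rw [← hw n h1 h2, ← hβdef]
    exact P.norm_emb_sq_le (w n)
  have hQ1 : τ * ∑ l ∈ Finset.Icc k N, ‖e l‖ ^ 2 ≤ β * (C₂ + 4 * C₃ / (1 - η)) * R := by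
    calc τ * ∑ l ∈ Finset.Icc k N, ‖e l‖ ^ 2 ≤ τ * (β * (P.b (w k) (w k) + B)) :=
          mul_le_mul_of_nonneg_left hQ hτ.le
      _ = β * (τ * P.b (w k) (w k) + τ * B) := by ring
      _ ≤ β * (C₂ * R + 4 * C₃ / (1 - η) * R) :=
          mul_le_mul_of_nonneg_left (add_le_add (by linarith) hB1) hβ.le
      _ = _ := by ring
  linarith

theorem mainTheorem2 (k δ : ℕ) (hk : 1 ≤ k) (hδ : 1 ≤ δ)
    (κ : ProblemConstants)
    (X : Type*) [NormedAddCommGroup X] [InnerProductSpace ℝ X] [CompleteSpace X] [Nontrivial X]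
    (η : ℝ) (G : ℝ → Matrix (Fin (k + δ)) (Fin (k + δ)) ℝ) (γ : ℝ → Fin (k + δ + 1) → ℝ)
    (hsum : SummationAssumption X k δ κ.coupling η G γ)
    (heig : UniformEigenvalueBounds κ.coupling G)
    (T : ℝ) (hT : 0 < T) (K : NNReal) :
    ∃ C : ℝ, 0 < C ∧
      ∀ (V Q H : Type*)
        [NormedAddCommGroup V] [InnerProductSpace ℝ V] [CompleteSpace V]
        [NormedAddCommGroup Q] [InnerProductSpace ℝ Q] [CompleteSpace Q]
        [NormedAddCommGroup H] [InnerProductSpace ℝ H] [CompleteSpace H]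
        (P : EllipticParabolic κ V Q H)
        (τ : ℝ) (_ : 0 < τ)
        (r : ℝ → (Q →L[ℝ] ℝ)) (pbar : ℝ → H) (p : ℤ → H)
        (_ : HasSobolevBound k K (-(δ * τ)) T pbar)
        (_ : P.IsDelaySolution δ τ T r pbar)
        (_ : P.IsBDFSolution k δ τ T r p)
        (_ : ∀ l ∈ Finset.Icc 1 δ, p (-(l : ℤ)) = pbar (-(l * τ)))
        (n : ℕ) (_ : n * τ ≤ T),
        ‖p n - pbar (n * τ)‖ ^ 2
            + τ * ∑ l ∈ Finset.Icc k n, ‖p l - pbar (l * τ)‖ ^ 2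
          ≤ C * (τ ^ (2 * k) + ∑ l ∈ Finset.range k, ‖p l - pbar (l * τ)‖ ^ 2) := by
  have hEv := κ.evolutionConst_pos δ
  have hBE := bdfErrorConst_nonneg k
  obtain ⟨C, hC, hstab⟩ := hsum.exists_stability hk hδ hT
    (D := κ.evolutionConst δ * (K * bdfErrorConst k)) (by positivity)
  -- the summand `1` covers the starting values `n < k`
  refine ⟨1 + C, by positivity, ?_⟩
  intro V Q H _ _ _ _ _ _ _ _ _ P τ hτ r pbar p hreg hpbar hp hhist N hN
  have hτk : 0 < τ ^ (2 * k) := by positivity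
  have hS : 0 ≤ ∑ l ∈ Finset.range k, ‖p l - pbar (l * τ)‖ ^ 2 :=
    Finset.sum_nonneg fun _ _ => sq_nonneg _
  rcases lt_or_ge N k with hNk | hkN
  · rw [Finset.Icc_eq_empty (by omega), Finset.sum_empty, mul_zero, add_zero]
    have h1 := Finset.single_le_sum (f := fun l : ℕ => ‖p l - pbar (l * τ)‖ ^ 2)
      (fun _ _ => sq_nonneg _) (Finset.mem_range.2 hNk)
    have h2 := mul_nonneg hC.le (add_nonneg hτk.le hS)
    linarith
  have h := hstab V Q H P τ hτ (fun i => p i - pbar (i * τ)) N hkN hN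
    (fun i h1 h2 => by
      obtain ⟨l, rfl⟩ : ∃ l : ℕ, i = -(l : ℤ) := ⟨i.natAbs, by omega⟩
      have h := hhist l (Finset.mem_Icc.2 ⟨by omega, by omega⟩)
      simp [h])
    (fun n h1 h2 => by
      have h3 : (n : ℝ) * τ ≤ N * τ := by gcongr
      have h := P.exists_error_equation hk hτ hreg hpbar hp h1 (h3.trans hN)
      simpa only [Int.cast_natCast] using h)
  simp only [Int.cast_natCast] at h
  linarith
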